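/- A lattice is a free $\mathbf{Z}$-module $L$ of finite rank with a symmetric bilinear form $q : L \times L \to \mathbf{Z}$. It is unimodular if the determinant of $q$ (of a Gram matrix of $q$) is $\pm 1$, and even if $q(x,x)$ is an even integer for all $x \in L$; its signature is the signature $(r,s)$ of the real quadratic form $x \mapsto q(x,x)$ on $L \otimes_{\mathbf{Z}} \mathbf{R}$. An isometry of $(L,q)$ is a $\mathbf{Z}$-linear map $t : L \to L$ with $q(tx,ty) = q(x,y)$ for all $x,y \in L$. Let $\Phi_n$ denote the $n$-th cyclotomic polynomial. Then the following hold. (a) Let $L$ be an even unimodular lattice of signature $(3,19)$. The lattice $L$ does not have any isometry $t : L \to L$ having both of the following properties: (i) the characteristic polynomial of $t$ is $\Phi_{60} C'$, where $C'$ is a product of cyclotomic polynomials (repetitions allowed); (ii) the signature of the sublattice $\mathrm{Ker}(\Phi_{60}(t))$ of $L$ is $(2,14)$. (b) Let $M$ be an even unimodular lattice of signature $(2,18)$. The lattice $M$ does not have any isometry $t : M \to M$ having both of the following properties: (i) the characteristic polynomial of $t$ is $\Phi_{60}\Phi_{12}$; (ii) the signature of the sublattice $\mathrm{Ker}(\Phi_{60}(t))$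 of $M$ is $(2,14)$. -/

import Mathlib

open scoped TensorProduct
open Polynomial

noncomputable section

/-! A lattice is a free `ℤ`-module `L` of finite rank with a symmetric bilinear form
`q : LinearMap.BilinForm ℤ L`. -/

/-- The determinant of a bilinear form on a free `ℤ`-module of finite rank: the determinant of its
Gram matrix in a basis (the choice of basis does not matter, see `latticeDet_eq`). -/
def latticeDet {L : Type*} [AddCommGroup L] [Module.Free ℤ L] [Module.Finite ℤ L]
    (q : LinearMap.BilinForm ℤ L) : ℤ :=
  (LinearMap.BilinForm.toMatrix (Module.Free.chooseBasis ℤ L) q).det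

/-- The signature of a bilinear form on a `ℤ`-module `L`: the signature `(r, s)` of the
real quadratic form `x ↦ q(x, x)` on `ℝ ⊗ L`. -/
def latticeSignature {L : Type*} [AddCommGroup L] (q : LinearMap.BilinForm ℤ L) : ℕ × ℕ :=
  (sigPos (LinearMap.BilinMap.toQuadraticMap (LinearMap.BilinForm.baseChange ℝ q)),
    sigNeg (LinearMap.BilinMap.toQuadraticMap (LinearMap.BilinForm.baseChange ℝ q)))

/-- `(L, q)` is an even unimodular lattice. -/
structure IsEvenUnimodularLattice {L : Type*} [AddCommGroup L] [Module.Free ℤ L]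
    [Module.Finite ℤ L] (q : LinearMap.BilinForm ℤ L) : Prop where
  symm : ∀ x y : L, q x y = q y x
  even : ∀ x : L, Even (q x x)
  unimodular : latticeDet q = 1 ∨ latticeDet q = -1

/-- The endomorphism `t` is an isometry of `(L, q)`. (If `q` is unimodular, such a `t` is
automatically bijective.) -/
def IsLatticeIsometry {L : Type*} [AddCommGroup L] (q : LinearMap.BilinForm ℤ L)
    (t : Module.End ℤ L) : Prop :=
  ∀ x y : L, q (t x) (t y) = q x y

/-- The sublattice `Ker (f(t))` of `L`. -/
def latticeKer {L : Type*} [AddCommGroup L] (t : Module.End ℤ L) (f : ℤ[X]) : Submodule ℤ L :=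
  LinearMap.ker (aeval t f)

/-- `f` is a product of cyclotomic polynomials, repetitions allowed. -/
def IsProductOfCyclotomics (f : ℤ[X]) : Prop :=
  ∃ s : Multiset ℕ, (∀ d ∈ s, 1 ≤ d) ∧ f = (s.map fun d => cyclotomic d ℤ).prod

theorem latticeDet_eq {L : Type*} [AddCommGroup L] [Module.Free ℤ L] [Module.Finite ℤ L]
    (q : LinearMap.BilinForm ℤ L) {ι : Type*} [Fintype ι] [DecidableEq ι]
    (b : Module.Basis ι ℤ L) :
    latticeDet q = (LinearMap.BilinForm.toMatrix b q).det := by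
  classical
  let c := (Module.Free.chooseBasis ℤ L).reindex
    ((Module.Free.chooseBasis ℤ L).indexEquiv b)
  have h1 : latticeDet q = (LinearMap.BilinForm.toMatrix c q).det := by
    rw [latticeDet, ← Matrix.det_submatrix_equiv_self
      ((Module.Free.chooseBasis ℤ L).indexEquiv b).symm]
    congr 1
    ext i j
    simp [c, LinearMap.BilinForm.toMatrix_apply]
  have h2 := LinearMap.BilinForm.toMatrix_mul_basis_toMatrix c b q
  have h3 : IsUnit (c.toMatrix b).det := by
    have := c.toMatrix_mul_toMatrix_flip b
    exact IsUnit.of_mul_eq_one _ (by rw [← Matrix.det_mul, this, Matrix.det_one])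
  rw [h1, ← h2, Matrix.det_mul, Matrix.det_mul, Matrix.det_transpose]
  rcases Int.isUnit_iff.1 h3 with h | h <;> simp [h]

end

/-! Put N = Ker Φ₆₀(t). Since Φ₆₀ divides X³⁰ + 1, the isometry t¹⁵ squares to -1 on N, so N is a
free ℤ[i]-module carrying the Hermitian form h(y, x) = q(y, x) + i q(y, ix). Let D be its Gram
determinant; three facts about D are incompatible. Away from 5 the form is unimodular: the cofactor
of Φ₆₀ in the characteristic polynomial has degree at most 6, and its cyclotomic factors satisfy a
Bézout relation with Φ₆₀ whose value is 5. As Ker Φ₆₀(t) and Im Φ₆₀(t) are orthogonal, unimodularity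
of the ambient lattice passes to N up to powers of 5, and D divides a power of 5. Signature (2, 14)
makes h of signature (1, 7), so D < 0. Hence D = -5^r ≡ 3 mod 4. But h(x, x) = q(x, x) is even, so
modulo 1 + i the form is alternating; splitting off planes of determinant ≡ -1 mod 4 shows that an
odd D in rank 8 is ≡ (-1)⁴ = 1 mod 4 (`GaussianInt.det_hermitian_mod_four`). -/

/-! ### Even Hermitian matrices over ℤ[i]. -/

/-- One step of the orthogonal splitting of an even Hermitian matrix over `ℤ[i]`: a unimodular
(at `1 + i`) plane is split off. -/
theorem GaussianInt.exists_hermitian_splitting {m : ℕ}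
    (H : Matrix (Fin 2 ⊕ Fin m) (Fin 2 ⊕ Fin m) GaussianInt) (hH : ∀ i j, star (H i j) = H j i)
    (hev : ∀ i, 2 ∣ (H i i).re)
    (hodd : ¬ 2 ∣ (H (.inl 0) (.inl 1)).re + (H (.inl 0) (.inl 1)).im) :
    ∃ (Δ : ℤ) (H' : Matrix (Fin m) (Fin m) GaussianInt), Δ % 4 = 3 ∧
      (∀ i j, star (H' i j) = H' j i) ∧ (∀ i, 2 ∣ (H' i i).re) ∧
      H.det * (Δ : GaussianInt) ^ m = Δ * H'.det := by
  have him : ∀ i, (H i i).im = 0 := fun i => by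
    have := congrArg Zsqrtd.im (hH i i)
    simp at this
    omega
  have hre : ∀ i j, (H j i).re = (H i j).re := fun i j => by rw [← hH i j]; simp
  have hneg : ∀ i j, (H j i).im = -(H i j).im := fun i j => by rw [← hH i j]; simp
  set E := H.toBlocks₁₁ with hE
  set F := H.toBlocks₁₂ with hF
  set C := H.toBlocks₂₁ with hC
  set G := H.toBlocks₂₂ with hG
  obtain ⟨Δ, hΔ⟩ : ∃ Δ : ℤ, (Δ : GaussianInt) = E.det := by
    refine ⟨E.det.re, ?_⟩
    rw [Matrix.det_fin_two, Zsqrtd.ext_iff]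
    simp [hE, Matrix.toBlocks₁₁, him, hneg (.inl 0) (.inl 1), hre (.inl 0) (.inl 1)]
    ring
  -- This is Δ times the Schur complement of E, which keeps the entries in ℤ[i].
  refine ⟨Δ, (Δ : GaussianInt) • G - C * E.adjugate * F, ?_, ?_, ?_, ?_⟩
  · have h1 := congrArg Zsqrtd.re hΔ
    rw [Matrix.det_fin_two] at h1
    simp [hE, Matrix.toBlocks₁₁, him, hneg (.inl 0) (.inl 1), hre (.inl 0) (.inl 1)] at h1
    obtain ⟨a, ha⟩ := hev (.inl 0)
    obtain ⟨b, hb⟩ := hev (.inl 1)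
    rw [ha, hb] at h1
    generalize (H (.inl 0) (.inl 1)).re = x at *
    generalize (H (.inl 0) (.inl 1)).im = y at *
    -- Here x + y is odd, so the norm x² + y² is 1 mod 4, while the product of the two even diagonal
    -- entries is 0 mod 4.
    obtain ⟨z, hz⟩ : ∃ z, x = 2 * z + 1 - y := ⟨(x + y) / 2, by omega⟩
    subst hz
    have h2 : Δ = 4 * (a * b - z ^ 2 - z + z * y) + 2 * (y - y * y) - 1 := by rw [h1]; ring
    have h3 : 2 ∣ y - y * y := by
      rcases Int.even_or_odd' y with ⟨k, rfl | rfl⟩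
      · exact ⟨k - 2 * k * k, by ring⟩
      · exact ⟨-k - 2 * k * k, by ring⟩
    omega
  · intro k l
    simp [Matrix.mul_apply, Fin.sum_univ_two, Matrix.adjugate_fin_two, hE, hF, hC, hG,
      Matrix.toBlocks₁₁, Matrix.toBlocks₁₂, Matrix.toBlocks₂₁, Matrix.toBlocks₂₂, hH]
    ring
  · intro k
    obtain ⟨a, ha⟩ := hev (.inl 0)
    obtain ⟨b, hb⟩ := hev (.inl 1)
    obtain ⟨c, hc⟩ := hev (.inr k)
    simp [Matrix.mul_apply, Fin.sum_univ_two, Matrix.adjugate_fin_two, hE, hF, hC, hG,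
      Matrix.toBlocks₁₁, Matrix.toBlocks₁₂, Matrix.toBlocks₂₁, Matrix.toBlocks₂₂, him,
      hneg (.inl 0) (.inl 1), hre (.inl 0) (.inl 1), hneg (.inl 0) (.inr k), hre (.inl 0) (.inr k),
      hneg (.inl 1) (.inr k), hre (.inl 1) (.inr k), ha, hb, hc]
    ring_nf
    omega
  · have h1 : H * Matrix.fromBlocks 1 (-(E.adjugate * F)) 0 ((Δ : GaussianInt) • 1) =
        Matrix.fromBlocks E 0 C ((Δ : GaussianInt) • G - C * E.adjugate * F) := by
      conv_lhs => rw [← Matrix.fromBlocks_toBlocks H]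
      rw [Matrix.fromBlocks_multiply]
      congr 1
      · simp [← hE]
      · rw [← hE, ← hF, Matrix.mul_neg, ← Matrix.mul_assoc, Matrix.mul_adjugate, hΔ]
        simp
      · simp [← hC]
      · simp [← hC, ← hG, Matrix.mul_assoc]
        abel
    have h2 := congrArg Matrix.det h1
    rw [Matrix.det_mul, Matrix.det_fromBlocks_zero₂₁, Matrix.det_fromBlocks_zero₁₂, ← hΔ] at h2
    simpa using h2

/-- The determinant of an even Hermitian matrix over `ℤ[i]`, modulo `4`. -/
theorem GaussianInt.det_hermitian_mod_four (n : ℕ) (H : Matrix (Fin n) (Fin n) GaussianInt)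
    (hH : ∀ i j, star (H i j) = H j i) (hev : ∀ i, 2 ∣ (H i i).re) (D : ℤ) (hD : H.det = D) :
    2 ∣ D ∨ (n % 4 = 0 ∧ D % 4 = 1) ∨ (n % 4 = 2 ∧ D % 4 = 3) := by
  induction n using Nat.strong_induction_on generalizing D with
  | _ n ih =>
  have him : ∀ i, (H i i).im = 0 := fun i => by
    have := congrArg Zsqrtd.im (hH i i)
    simp at this
    omega
  by_cases hall : ∀ i j, 2 ∣ (H i j).re + (H i j).im
  · rcases Nat.eq_zero_or_pos n with rfl | hn
    · right; left
      simp at hD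
      have : D = 1 := by exact_mod_cast hD.symm
      simp [this]
    · left
      -- Reduction modulo 1 + i, sending i to 1.
      let φ : GaussianInt →+* ZMod 2 := Zsqrtd.lift ⟨1, by decide⟩
      have hφ : ∀ z : GaussianInt, 2 ∣ z.re + z.im → φ z = 0 := fun z hz => by
        have := (ZMod.intCast_zmod_eq_zero_iff_dvd (z.re + z.im) 2).2 (by exact_mod_cast hz)
        simpa [φ, Zsqrtd.lift] using this
      have h0 : φ.mapMatrix H = 0 := by
        ext i j
        exact hφ _ (hall i j)
      have h1 : φ H.det = 0 := by
        rw [RingHom.map_det, h0]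
        have : Nonempty (Fin n) := ⟨⟨0, hn⟩⟩
        exact Matrix.det_zero
      rw [hD, map_intCast] at h1
      exact_mod_cast (ZMod.intCast_zmod_eq_zero_iff_dvd D 2).1 h1
  · push Not at hall
    obtain ⟨a, b, hab⟩ := hall
    have hne : a ≠ b := by
      rintro rfl
      rw [him, add_zero] at hab
      exact hab (hev a)
    obtain ⟨m, rfl⟩ : ∃ m, n = 2 + m := by
      refine ⟨n - 2, ?_⟩
      have := a.2; have := b.2
      have : (a : ℕ) ≠ b := fun h => hne (Fin.ext h)
      omega
    obtain ⟨e, ha, hb⟩ : ∃ e : Fin 2 ⊕ Fin m ≃ Fin (2 + m), e (.inl 0) = a ∧ e (.inl 1) = b := by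
      let e₀ : Fin 2 ⊕ Fin m ≃ Fin (2 + m) := finSumFinEquiv
      let e₁ := e₀.trans (Equiv.swap (e₀ (.inl 0)) a)
      have h1 : e₁ (.inl 0) = a := by simp [e₁]
      refine ⟨e₁.trans (Equiv.swap (e₁ (.inl 1)) b), ?_, by simp⟩
      rw [Equiv.trans_apply, h1]
      refine Equiv.swap_apply_of_ne_of_ne ?_ hne
      rw [← h1]
      exact fun h => by simpa using e₁.injective h
    obtain ⟨Δ, H', hΔ, hH', hev', hdet⟩ :=
      GaussianInt.exists_hermitian_splitting (H.submatrix e e) (fun i j => hH _ _)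
        (fun i => hev _) (by simpa [ha, hb] using hab)
    rw [Matrix.det_submatrix_equiv_self, hD] at hdet
    have hD'im : H'.det.im = 0 := by
      have := congrArg Zsqrtd.im hdet
      have h2 : ((D : GaussianInt) * (Δ : GaussianInt) ^ m).im = 0 := by
        rw [← Int.cast_pow, ← Int.cast_mul]; exact Zsqrtd.im_intCast _
      rw [h2] at this
      simp at this
      omega
    have hD' : H'.det = (H'.det.re : GaussianInt) := by
      rw [Zsqrtd.ext_iff]; simp [hD'im]
    have key := ih m (by omega) H' hH' hev' _ hD'
    rw [hD'] at hdet
    have hdet' : D * Δ ^ m = Δ * H'.det.re := by exact_mod_cast hdet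
    generalize H'.det.re = D' at hdet' key
    have hΔ2 : Δ ^ 2 % 4 = 1 := by rw [pow_two, Int.mul_emod, hΔ]; rfl
    have hev : ∀ k, Δ ^ (2 * k) % 4 = 1 := fun k => by
      rw [pow_mul]
      have : (Δ ^ 2) ^ k ≡ 1 ^ k [ZMOD 4] := Int.ModEq.pow k hΔ2
      rw [one_pow] at this
      exact this
    -- For even m the factor Δ^m is 1 mod 4, so each split plane contributes a sign -1.
    have hmul : ∀ {k}, m = 2 * k → D % 4 = (3 * D') % 4 := fun {k} hk => by
      have h1 : D * Δ ^ m ≡ D * 1 [ZMOD 4] := Int.ModEq.mul_left _ (by rw [hk]; exact hev k)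
      have h2 : Δ * D' ≡ 3 * D' [ZMOD 4] := Int.ModEq.mul_right _ hΔ
      rw [hdet', mul_one] at h1
      exact h1.symm.trans h2
    rcases key with h | ⟨h, h'⟩ | ⟨h, h'⟩
    · left
      have h1 : (2 : ℤ) ∣ D * Δ ^ m := hdet' ▸ h.mul_left Δ
      rcases Int.prime_two.dvd_or_dvd h1 with h2 | h2
      · exact h2
      · have := Int.prime_two.dvd_of_dvd_pow h2
        omega
    · have := hmul (k := m / 2) (by omega)
      omega
    · have := hmul (k := m / 2) (by omega)
      omega

/-! ### Φ₆₀ and its Bézout relations with cyclotomic polynomials of small degree. -/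

theorem cyclotomic_sixty : cyclotomic 60 ℤ =
    X ^ 16 + X ^ 14 - X ^ 10 - X ^ 8 - X ^ 6 + X ^ 2 + 1 := by
  have h5 : cyclotomic 5 ℤ = X ^ 4 + X ^ 3 + X ^ 2 + X + 1 := by
    have : Fact (Nat.Prime 5) := ⟨by norm_num⟩
    rw [cyclotomic_prime]
    simp [Finset.sum_range_succ]
    ring
  have h10 : cyclotomic 10 ℤ = X ^ 4 - X ^ 3 + X ^ 2 - X + 1 := by
    have h := cyclotomic_expand_eq_cyclotomic_mul Nat.prime_two (n := 5) (by norm_num) ℤ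
    apply mul_right_cancel₀ (cyclotomic_ne_zero 5 ℤ)
    rw [show 5 * 2 = 10 from rfl] at h
    rw [← h, h5]
    simp
    ring
  have h20 : cyclotomic 20 ℤ = X ^ 8 - X ^ 6 + X ^ 4 - X ^ 2 + 1 := by
    have h := cyclotomic_expand_eq_cyclotomic Nat.prime_two (n := 10) (by norm_num) ℤ
    rw [show 10 * 2 = 20 from rfl] at h
    rw [← h, h10]
    simp
    ring
  have h := cyclotomic_expand_eq_cyclotomic_mul Nat.prime_three (n := 20) (by norm_num) ℤ
  apply mul_right_cancel₀ (cyclotomic_ne_zero 20 ℤ)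
  rw [show 20 * 3 = 60 from rfl] at h
  rw [← h, h20]
  simp
  ring

theorem cyclotomic_sixty_dvd_X_pow_sub_one : cyclotomic 60 ℤ ∣ X ^ 60 - 1 :=
  cyclotomic.dvd_X_pow_sub_one 60 ℤ

theorem cyclotomic_sixty_dvd_geom_sum {e p : ℕ} (h : e * p = 60) (hp : 1 < p) :
    cyclotomic 60 ℤ ∣ ∑ i ∈ Finset.range p, (X ^ e) ^ i := by
  have he : 0 < e := Nat.pos_of_ne_zero (by rintro rfl; simp at h)
  have h1 := X_pow_sub_one_mul_cyclotomic_dvd_X_pow_sub_one_of_dvd ℤ (d := e) (n := 60)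
    (Nat.mem_properDivisors.2 ⟨⟨p, h.symm⟩, by nlinarith⟩)
  have h2 : (X ^ 60 - 1 : ℤ[X]) = (X ^ e - 1) * ∑ i ∈ Finset.range p, (X ^ e) ^ i := by
    rw [mul_geom_sum, ← pow_mul, h]
  rw [h2] at h1
  exact (mul_dvd_mul_iff_left (X_pow_sub_C_ne_zero he 1)).1 h1

theorem cyclotomic_sixty_dvd_X_pow_thirty_add_one : cyclotomic 60 ℤ ∣ X ^ 30 + 1 := by
  have := cyclotomic_sixty_dvd_geom_sum (e := 30) (p := 2) rfl (by norm_num)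
  simpa [Finset.sum_range_succ, add_comm] using this

/-- If `x` is a root of `Φ₆₀` and `Φ_d`, where `gcd (60, d)` divides `60 / p`, then `p = 0`. -/
theorem natCast_eq_zero_of_aeval_cyclotomic_sixty {R : Type*} [CommRing R] {x : R} {d e p : ℕ}
    (h60 : aeval x (cyclotomic 60 ℤ) = 0) (hd : aeval x (cyclotomic d ℤ) = 0)
    (hep : e * p = 60) (hp : 1 < p) (he : Nat.gcd 60 d ∣ e) : (p : R) = 0 := by
  have hz : ∀ {f g : ℤ[X]}, aeval x f = 0 → f ∣ g → aeval x g = 0 := by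
    rintro f _ hf ⟨g, rfl⟩
    rw [map_mul, hf, zero_mul]
  have h1 : x ^ 60 = 1 := by
    simpa [sub_eq_zero] using hz h60 cyclotomic_sixty_dvd_X_pow_sub_one
  have h2 : x ^ d = 1 := by
    simpa [sub_eq_zero] using hz hd (cyclotomic.dvd_X_pow_sub_one d ℤ)
  have h3 : x ^ e = 1 :=
    orderOf_dvd_iff_pow_eq_one.1
      ((Nat.dvd_gcd (orderOf_dvd_of_pow_eq_one h1) (orderOf_dvd_of_pow_eq_one h2)).trans he)
  simpa [h3] using hz h60 (cyclotomic_sixty_dvd_geom_sum hep hp)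

/-- In the quotient by both polynomials, the class of X has order dividing g = gcd(60, d), which
forces 60/e = 0 for every proper divisor e of 60 that is a multiple of g. The bound on φ(d) excludes
g = 15, 20, 30, 60. -/
theorem exists_mul_cyclotomic_sixty_add {d : ℕ} (hd : Nat.totient d ≤ 6) (hd0 : 1 ≤ d) :
    ∃ A B : ℤ[X], A * cyclotomic 60 ℤ + B * cyclotomic d ℤ = 5 := by
  rw [← Ideal.mem_span_pair, ← Ideal.Quotient.eq_zero_iff_mem]
  set I := Ideal.span {cyclotomic 60 ℤ, cyclotomic d ℤ} with hI
  have hroot : ∀ f ∈ I, aeval (Ideal.Quotient.mk I X) f = 0 := fun f hf => by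
    have h : aeval (Ideal.Quotient.mk I X) f = Ideal.Quotient.mkₐ ℤ I (aeval X f) := by
      rw [← aeval_algHom_apply]; rfl
    rw [h, aeval_X_left_apply]
    exact Ideal.Quotient.eq_zero_iff_mem.2 hf
  have h60 := hroot _ (Ideal.subset_span (by simp) : cyclotomic 60 ℤ ∈ I)
  have hdd := hroot _ (Ideal.subset_span (by simp) : cyclotomic d ℤ ∈ I)
  have hle : ∀ {m}, m ∣ d → Nat.totient m ≤ 6 := fun h =>
    (Nat.le_of_dvd (Nat.totient_pos.2 hd0) (Nat.totient_dvd_of_dvd h)).trans hd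
  have hg60 : Nat.gcd 60 d ∣ 60 := Nat.gcd_dvd_left 60 d
  have hgd : Nat.gcd 60 d ∣ d := Nat.gcd_dvd_right 60 d
  have hmem : Nat.gcd 60 d ∈ Nat.divisors 60 := Nat.mem_divisors.2 ⟨hg60, by norm_num⟩
  have hg := hle hgd
  generalize hgg : Nat.gcd 60 d = g at *
  have hcases : g ∣ 12 ∨ g ∣ 10 := by
    have hdiv : Nat.divisors 60 = {1, 2, 3, 4, 5, 6, 10, 12, 15, 20, 30, 60} := by decide +kernel
    rw [hdiv] at hmem
    simp only [Finset.mem_insert, Finset.mem_singleton] at hmem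
    rcases hmem with h | h | h | h | h | h | h | h | h | h | h | h <;> subst h <;>
      first | decide | (exfalso; revert hg; decide +kernel)
  rcases hcases with h | h
  · exact_mod_cast natCast_eq_zero_of_aeval_cyclotomic_sixty h60 hdd (e := 12) (p := 5) rfl
      (by norm_num) (hgg ▸ h)
  -- For g dividing 10 both 2 and 3 vanish, so the ideal is the whole ring; 5 = 2 + 3 keeps the
  -- constant uniform.
  · have h2 := natCast_eq_zero_of_aeval_cyclotomic_sixty h60 hdd (e := 30) (p := 2) rfl
      (by norm_num) (hgg ▸ h.trans (by norm_num))
    have h3 := natCast_eq_zero_of_aeval_cyclotomic_sixty h60 hdd (e := 20) (p := 3) rfl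
      (by norm_num) (hgg ▸ h.trans (by norm_num))
    have : (5 : ℤ[X] ⧸ I) = (2 : ℕ) + (3 : ℕ) := by norm_num
    rw [map_ofNat, this, h2, h3, add_zero]

theorem IsProductOfCyclotomics.exists_mul_cyclotomic_sixty_add {f : ℤ[X]}
    (hf : IsProductOfCyclotomics f) (hdeg : f.natDegree ≤ 6) :
    ∃ (A B : ℤ[X]) (k : ℕ), A * cyclotomic 60 ℤ + B * f = 5 ^ k := by
  obtain ⟨s, hs, rfl⟩ := hf
  have hne : (s.map fun d => cyclotomic d ℤ).prod ≠ 0 :=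
    (monic_multiset_prod_of_monic _ _ fun d _ => cyclotomic.monic d ℤ).ne_zero
  have hle : ∀ d ∈ s, Nat.totient d ≤ 6 := fun d hd => by
    rw [← natDegree_cyclotomic d ℤ]
    exact (natDegree_le_of_dvd (Multiset.dvd_prod (Multiset.mem_map_of_mem _ hd)) hne).trans hdeg
  clear hne hdeg
  induction s using Multiset.induction_on with
  | empty => exact ⟨0, 1, 0, by simp⟩
  | cons d s ih =>
    obtain ⟨A, B, k, h⟩ := ih (fun e he => hs e (Multiset.mem_cons_of_mem he))
      (fun e he => hle e (Multiset.mem_cons_of_mem he))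
    obtain ⟨A', B', h'⟩ := _root_.exists_mul_cyclotomic_sixty_add
      (hle d (Multiset.mem_cons_self d s)) (hs d (Multiset.mem_cons_self d s))
    refine ⟨A * 5 + B * (s.map fun d => cyclotomic d ℤ).prod * A', B * B', k + 1, ?_⟩
    rw [Multiset.map_cons, Multiset.prod_cons, pow_succ, ← h]
    linear_combination (B * (s.map fun d => cyclotomic d ℤ).prod) * h'

/-! ### Signatures of complex Hermitian forms. -/

/-- A real quadratic form that pulls back to `∑ λᵢ |zᵢ|²` on `ℂ^ι` has positive index at least
twice the number of positive `λᵢ`. -/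
theorem two_mul_card_pos_le_sigPos {ι E : Type*} [Fintype ι] [AddCommGroup E] [Module ℝ E]
    [Module.Finite ℝ E] (Q : QuadraticForm ℝ E) (ψ : (ι → ℂ) →ₗ[ℝ] E) (w : ι → ℝ)
    (hψ : ∀ z, Q (ψ z) = ∑ i, w i * Complex.normSq (z i)) :
    2 * Fintype.card {i // 0 < w i} ≤ sigPos Q := by
  classical
  let e : ({i // 0 < w i} → ℂ) →ₗ[ℝ] (ι → ℂ) :=
    { toFun := fun z i => if h : 0 < w i then z ⟨i, h⟩ else 0
      map_add' := fun x y => by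
        ext i
        by_cases h : 0 < w i <;> simp [h]
      map_smul' := fun c x => by
        ext i
        by_cases h : 0 < w i <;> simp [h] }
  have hpos : ∀ z, z ≠ 0 → 0 < Q (ψ (e z)) := by
    intro z hz
    obtain ⟨i, hi⟩ := Function.ne_iff.1 hz
    rw [hψ]
    refine Finset.sum_pos' (fun j _ => ?_) ⟨i, Finset.mem_univ _, ?_⟩
    · by_cases h : 0 < w j
      · exact mul_nonneg h.le (Complex.normSq_nonneg _)
      · simp [e, h]
    · have : e z i = z i := by simp [e, i.2]
      rw [this]
      exact mul_pos i.2 (Complex.normSq_pos.2 hi)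
  have hinj : Function.Injective (ψ ∘ₗ e) := by
    rw [injective_iff_map_eq_zero]
    intro z hz
    by_contra hne
    have h := hpos z hne
    rw [← LinearMap.comp_apply, hz, map_zero] at h
    exact lt_irrefl _ h
  have hle := le_sigPos_of_posDef Q (V := LinearMap.range (ψ ∘ₗ e)) (by
    rintro ⟨_, z, rfl⟩ hne
    exact hpos z (by rintro rfl; exact hne (by ext; simp)))
  rw [LinearMap.finrank_range_of_inj hinj, Module.finrank_pi_fintype] at hle
  simpa [Complex.finrank_real_complex, mul_comm] using hle

theorem Matrix.IsHermitian.re_dotProduct_eigenvectorUnitary {ι : Type*} [Fintype ι]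
    [DecidableEq ι] {H : Matrix ι ι ℂ} (hH : H.IsHermitian) (z : ι → ℂ) :
    (star ((hH.eigenvectorUnitary : Matrix ι ι ℂ).mulVec z) ⬝ᵥ
      H.mulVec ((hH.eigenvectorUnitary : Matrix ι ι ℂ).mulVec z)).re =
      ∑ i, hH.eigenvalues i * Complex.normSq (z i) := by
  have h := hH.conjStarAlgAut_star_eigenvectorUnitary
  rw [Unitary.conjStarAlgAut_star_apply] at h
  rw [Matrix.star_mulVec, ← Matrix.dotProduct_mulVec, Matrix.mulVec_mulVec, Matrix.mulVec_mulVec,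
    ← Matrix.star_eq_conjTranspose, h]
  simp only [dotProduct, Matrix.mulVec_diagonal, Complex.re_sum]
  refine Finset.sum_congr rfl fun i _ => ?_
  simp [Complex.normSq_apply]
  ring

/-- If the real form attached to a Hermitian matrix has signature `(2, 14)` on a space of dimension
`2 n` then `n = 8` and the determinant is negative. -/
theorem Matrix.IsHermitian.det_neg_of_signature {E : Type*} {n : ℕ} [AddCommGroup E] [Module ℝ E]
    [Module.Finite ℝ E] (hE : Module.finrank ℝ E = 2 * n) {H : Matrix (Fin n) (Fin n) ℂ}
    (hH : H.IsHermitian) (Q : QuadraticForm ℝ E) (ψ : (Fin n → ℂ) →ₗ[ℝ] E)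
    (hψ : ∀ z, Q (ψ z) = (star z ⬝ᵥ H.mulVec z).re) (hdet : H.det ≠ 0)
    (hpos : sigPos Q = 2) (hneg : sigNeg Q = 14) : n = 8 ∧ H.det.re < 0 := by
  have hD := hH.det_eq_prod_eigenvalues
  have hne : ∀ i, hH.eigenvalues i ≠ 0 := by
    rw [hD] at hdet
    intro i hi
    exact hdet (Finset.prod_eq_zero (Finset.mem_univ i) (by simp [hi]))
  let U : (Fin n → ℂ) →ₗ[ℝ] (Fin n → ℂ) :=
    ((hH.eigenvectorUnitary : Matrix (Fin n) (Fin n) ℂ).mulVecLin).restrictScalars ℝ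
  have hU : ∀ z, Q ((ψ ∘ₗ U) z) = ∑ i, hH.eigenvalues i * Complex.normSq (z i) := fun z => by
    rw [LinearMap.comp_apply, hψ]
    exact hH.re_dotProduct_eigenvectorUnitary z
  have h1 := two_mul_card_pos_le_sigPos Q (ψ ∘ₗ U) hH.eigenvalues hU
  have h2 := two_mul_card_pos_le_sigPos (-Q) (ψ ∘ₗ U) (-hH.eigenvalues) (fun z => by
    rw [_root_.neg_apply, hU, ← Finset.sum_neg_distrib]
    exact Finset.sum_congr rfl fun i _ => by simp)
  rw [hpos] at h1
  rw [sigPos_neg, hneg] at h2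
  simp only [Pi.neg_apply, Left.neg_pos_iff] at h2
  -- There are at most 1 positive and 7 negative eigenvalues and none is zero, so n ≤ 8; this bound
  -- gives n ≥ 8, hence exactly 7 negative ones.
  have h3 : 2 + 14 ≤ 2 * n := by
    rw [← hE, ← QuadraticForm.sigPos_add_sigNeg_add_radical (Q := Q), hpos, hneg]
    omega
  have h4 := Fintype.card_subtype_compl fun i => 0 < hH.eigenvalues i
  have h5 : Fintype.card {i // ¬ 0 < hH.eigenvalues i} =
      Fintype.card {i // hH.eigenvalues i < 0} :=
    Fintype.card_congr (Equiv.subtypeEquivRight fun i =>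
      ⟨fun h => lt_of_le_of_ne (not_lt.1 h) (hne i), fun h => not_lt.2 h.le⟩)
  have h6 := Fintype.card_subtype_le fun i => 0 < hH.eigenvalues i
  rw [h5] at h4
  rw [Fintype.card_fin] at h4 h6
  refine ⟨by omega, ?_⟩
  have h7 : H.det.re = ∏ i, hH.eigenvalues i := by
    rw [hD]
    simp [← Complex.ofReal_prod]
  have h8 : Fintype.card {i // hH.eigenvalues i < 0} = 7 := by omega
  rw [h7, ← Finset.prod_filter_mul_prod_filter_not Finset.univ fun i => hH.eigenvalues i < 0]
  refine mul_neg_of_neg_of_pos ?_ (Finset.prod_pos fun i hi => ?_)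
  · rw [← neg_pos]
    have h9 : ∏ i with hH.eigenvalues i < 0, -hH.eigenvalues i =
        -∏ i with hH.eigenvalues i < 0, hH.eigenvalues i := by
      rw [Finset.prod_neg, ← Fintype.card_subtype, h8]
      norm_num
    rw [← h9]
    exact Finset.prod_pos fun i hi => neg_pos.2 (Finset.mem_filter.1 hi).2
  · exact lt_of_le_of_ne (not_lt.1 (Finset.mem_filter.1 hi).2) (hne i).symm

/-! ### Even Hermitian lattices over ℤ[i]. -/

theorem GaussianInt.finrank_int : Module.finrank ℤ GaussianInt = 2 ∧ Module.Free ℤ GaussianInt := by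
  let e : (ℤ × ℤ) ≃ₗ[ℤ] GaussianInt :=
    { toFun := fun p => ⟨p.1, p.2⟩
      invFun := fun z => (z.re, z.im)
      map_add' := fun x y => by ext <;> simp
      map_smul' := fun c x => by ext <;> simp
      left_inv := fun x => rfl
      right_inv := fun x => rfl }
  exact ⟨by rw [← e.finrank_eq]; simp, Module.Free.of_equiv e⟩

theorem Int.emod_four_of_dvd_five_pow {D : ℤ} {M : ℕ} (h : D ∣ 5 ^ M) (hneg : D < 0) :
    D % 4 = 3 := by
  have h1 : D.natAbs ∣ 5 ^ M := by
    have := Int.natAbs_dvd_natAbs.2 h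
    rwa [Int.natAbs_pow] at this
  obtain ⟨r, -, hr⟩ := (Nat.dvd_prime_pow Nat.prime_five).1 h1
  have h2 : (5 : ℕ) ^ r % 4 = 1 := by
    rw [Nat.pow_mod]; simp
  omega

/-- An even lattice with multiplication by `ℤ[i]`, acting by isometries through `i`, which is
unimodular away from `5`, does not have signature `(2, 14)`. -/
theorem latticeSignature_ne_of_gaussianInt_module {N : Type*} [AddCommGroup N] [Module.Free ℤ N]
    [Module.Finite ℤ N] [Module GaussianInt N] (q : LinearMap.BilinForm ℤ N)
    (hsymm : ∀ x y, q x y = q y x) (heven : ∀ x, Even (q x x))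
    (hi : ∀ x y : N, q ((⟨0, 1⟩ : GaussianInt) • x) ((⟨0, 1⟩ : GaussianInt) • y) = q x y) (k : ℕ)
    (hdual : ∀ f : N →ₗ[ℤ] ℤ, ∃ y, ∀ x, q y x = 5 ^ k * f x) :
    latticeSignature q ≠ (2, 14) := by
  intro hsig
  set I : GaussianInt := ⟨0, 1⟩ with hI
  have hII : ∀ x : N, I • I • x = -x := fun x => by
    rw [smul_smul, show I * I = -1 from rfl, neg_one_smul]
  have hskew : ∀ x y : N, q (I • x) y = -q x (I • y) := fun x y => by
    rw [← hi (I • x) y, hII]; simp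
  have hsmul : ∀ (z : GaussianInt) (x : N), z • x = z.re • x + z.im • I • x := fun z x => by
    conv_lhs => rw [show z = (z.re : GaussianInt) + (z.im : GaussianInt) * I by
      ext <;> simp [hI]]
    rw [add_smul, mul_smul, Int.cast_smul_eq_zsmul, Int.cast_smul_eq_zsmul]
  obtain ⟨hfr, hfree⟩ := GaussianInt.finrank_int
  have : Module.IsTorsionFree GaussianInt N := .of_smul_eq_zero fun z x h => by
    have h1 : z.norm • x = 0 := by
      rw [← Int.cast_smul_eq_zsmul GaussianInt, Zsqrtd.norm_eq_mul_conj, mul_comm, mul_smul, h,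
        smul_zero]
    rcases smul_eq_zero.1 h1 with h2 | h2
    · exact Or.inl (GaussianInt.norm_eq_zero.1 h2)
    · exact Or.inr h2
  have : Module.Finite GaussianInt N := Module.Finite.of_restrictScalars_finite ℤ GaussianInt N
  have b := Module.finBasis GaussianInt N
  set n := Module.finrank GaussianInt N with hn
  have hrank : Module.finrank ℤ N = 2 * n := by
    rw [← Module.finrank_mul_finrank ℤ GaussianInt N, hfr]
  -- The Hermitian form, linear in y and conjugate-linear in x.
  let g : N → N →ₗ[GaussianInt] GaussianInt := fun x =>
    { toFun := fun y => ⟨q y x, q y (I • x)⟩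
      map_add' := fun y y' => by ext <;> simp
      map_smul' := fun z y => by
        rw [hsmul z y]
        ext <;> simp [hskew, hII] }
  let G : Matrix (Fin n) (Fin n) GaussianInt := fun a c => g (b c) (b a)
  have hGre : ∀ a c, (G a c).re = q (b a) (b c) := fun a c => rfl
  have hGim : ∀ a c, (G a c).im = q (b a) (I • b c) := fun a c => rfl
  have hG : ∀ a c, star (G a c) = G c a := fun a c => by
    ext
    · simp [hGre, hsymm (b a) (b c)]
    · simp [hGim, hsymm (b c) (I • b a), hskew]
  obtain ⟨D, hD⟩ : ∃ D : ℤ, G.det = D := by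
    refine ⟨G.det.re, ?_⟩
    have h1 : star G.det = G.det := by
      rw [← Matrix.det_conjTranspose]
      congr 1
      ext1 a c
      exact hG c a
    have h2 := congrArg Zsqrtd.im h1
    rw [Zsqrtd.ext_iff]
    simp at h2 ⊢
    omega
  have hdvd : D ∣ 5 ^ (k * n) := by
    -- Real parts of coordinates suffice: evaluating them at I • x recovers the imaginary parts, so
    -- the `y a` form a Hermitian dual basis up to 5^k.
    let f : Fin n → N →ₗ[ℤ] ℤ := fun a =>
      { toFun := fun x => (b.repr x a).re
        map_add' := fun x y => by simp
        map_smul' := fun c x => by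
          rw [← Int.cast_smul_eq_zsmul GaussianInt, map_smul]
          simp }
    choose y hy using fun a => hdual (f a)
    have h1 : (Matrix.of fun a c => b.repr (y a) c) * G = (5 ^ k : GaussianInt) • 1 := by
      ext1 a c
      rw [Matrix.mul_apply]
      have h2 : ∑ d, b.repr (y a) d * G d c = g (b c) (y a) := by
        conv_rhs => rw [← b.sum_repr (y a), map_sum]
        exact Finset.sum_congr rfl fun d _ => by rw [map_smul, smul_eq_mul]
      simp only [Matrix.of_apply]
      rw [h2]
      have h3 : g (b c) (y a) = ⟨5 ^ k * (b.repr (b c) a).re, 5 ^ k * (b.repr (I • b c) a).re⟩ := by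
        rw [Zsqrtd.ext_iff]
        exact ⟨hy a _, hy a _⟩
      have h5 : (5 ^ k : GaussianInt) = ((5 ^ k : ℤ) : GaussianInt) := by push_cast; rfl
      rw [h3, h5]
      generalize (5 ^ k : ℤ) = M
      by_cases hac : c = a
      · subst hac
        ext <;> simp [hI]
      · ext <;> simp [hI, Finsupp.single_eq_of_ne (Ne.symm hac),
          Matrix.one_apply_ne (Ne.symm hac)]
    have h2 := congrArg Matrix.det h1
    rw [Matrix.det_mul, hD, Matrix.det_smul, Matrix.det_one, mul_one, Fintype.card_fin,
      ← pow_mul] at h2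
    have h3 := congrArg Zsqrtd.re h2
    rw [show (5 ^ (k * n) : GaussianInt) = ((5 ^ (k * n) : ℤ) : GaussianInt) by push_cast; rfl] at h3
    simp only [Zsqrtd.re_mul, Zsqrtd.re_intCast, Zsqrtd.im_intCast, mul_zero, add_zero] at h3
    exact ⟨_, by rw [← h3, mul_comm]⟩
  have hD0 : D ≠ 0 := by
    rintro rfl
    exact pow_ne_zero _ (by norm_num) (zero_dvd_iff.1 hdvd)
  set H : Matrix (Fin n) (Fin n) ℂ := GaussianInt.toComplex.mapMatrix G with hH
  have hHdet : H.det = (D : ℂ) := by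
    rw [hH, ← RingHom.map_det, hD, map_intCast]
  have hHerm : H.IsHermitian := by
    ext a c
    simp only [hH, RingHom.mapMatrix_apply, Matrix.conjTranspose_apply, Matrix.map_apply]
    rw [← hG a c, GaussianInt.toComplex_star]
    simp
  -- The vector z goes to the combination of the basis with coefficients conj(z a), because the form
  -- is linear in its first variable while `star z ⬝ᵥ H.mulVec z` conjugates there.
  let ψ : (Fin n → ℂ) →ₗ[ℝ] ℝ ⊗[ℤ] N :=
    ∑ a, ((LinearMap.toSpanSingleton ℝ (ℝ ⊗[ℤ] N) (1 ⊗ₜ b a)) ∘ₗ Complex.reLm -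
      (LinearMap.toSpanSingleton ℝ (ℝ ⊗[ℤ] N) (1 ⊗ₜ (I • b a))) ∘ₗ Complex.imLm) ∘ₗ
        LinearMap.proj a
  obtain ⟨hpos, hneg⟩ := Prod.mk.inj hsig
  obtain ⟨h8, hlt⟩ := hHerm.det_neg_of_signature (E := ℝ ⊗[ℤ] N)
    (by rw [Module.finrank_baseChange, hrank]) _ ψ (fun z => by
      have hψz : ψ z = ∑ a, ((z a).re • ((1 : ℝ) ⊗ₜ[ℤ] b a) -
          (z a).im • ((1 : ℝ) ⊗ₜ[ℤ] (I • b a))) := by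
        simp [ψ, LinearMap.sum_apply]
      rw [LinearMap.BilinMap.toQuadraticMap_apply, hψz]
      simp only [map_sum, LinearMap.sum_apply, dotProduct, Matrix.mulVec, Complex.re_sum,
        Finset.mul_sum]
      rw [Finset.sum_comm]
      refine Finset.sum_congr rfl fun a _ => Finset.sum_congr rfl fun c _ => ?_
      have hre : (H a c).re = q (b a) (b c) := by
        rw [← hGre a c, GaussianInt.intCast_re]; rfl
      have him : (H a c).im = q (b a) (I • b c) := by
        rw [← hGim a c, GaussianInt.intCast_im]; rfl
      simp [hre, him, hi, hskew]
      ring) (by rw [hHdet]; exact_mod_cast hD0) hpos hneg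
  rw [hHdet] at hlt
  have hlt' : D < 0 := by
    rw [← Complex.ofReal_intCast, Complex.ofReal_re] at hlt
    exact_mod_cast hlt
  have h3 := Int.emod_four_of_dvd_five_pow hdvd hlt'
  have := GaussianInt.det_hermitian_mod_four n G hG
    (fun a => (heven (b a)).two_dvd) D hD
  omega

theorem latticeSignature_ne_of_sq_eq_neg {N : Type*} [AddCommGroup N] [Module.Free ℤ N]
    [Module.Finite ℤ N] (q : LinearMap.BilinForm ℤ N)
    (hsymm : ∀ x y, q x y = q y x) (heven : ∀ x, Even (q x x)) (j : Module.End ℤ N)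
    (hjj : j * j = -1) (hj : IsLatticeIsometry q j) (k : ℕ)
    (hdual : ∀ f : N →ₗ[ℤ] ℤ, ∃ y, ∀ x, q y x = 5 ^ k * f x) :
    latticeSignature q ≠ (2, 14) := by
  let φ : GaussianInt →+* Module.End ℤ N :=
    { toFun := fun z => z.re • 1 + z.im • j
      map_one' := by simp
      map_zero' := by simp
      map_add' := fun x y => by simp only [Zsqrtd.re_add, Zsqrtd.im_add]; module
      map_mul' := fun x y => by
        simp only [Zsqrtd.re_mul, Zsqrtd.im_mul, mul_add, add_mul, smul_mul_smul_comm, hjj, one_mul,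
          mul_one]
        module }
  let _ : Module GaussianInt N := Module.compHom N φ
  have hI : ∀ x : N, (⟨0, 1⟩ : GaussianInt) • x = j x := fun x => by
    change φ ⟨0, 1⟩ x = j x
    simp [φ]
  exact latticeSignature_ne_of_gaussianInt_module q hsymm heven
    (fun x y => by rw [hI, hI]; exact hj x y) k hdual

/-! ### Unimodular lattices and the kernel of Φ₆₀(t). -/

theorem IsEvenUnimodularLattice.exists_forall_eq {L : Type*} [AddCommGroup L] [Module.Free ℤ L]
    [Module.Finite ℤ L] {q : LinearMap.BilinForm ℤ L} (hq : IsEvenUnimodularLattice q)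
    (f : L →ₗ[ℤ] ℤ) : ∃ y, ∀ x, q y x = f x := by
  let b := Module.Free.chooseBasis ℤ L
  set G := LinearMap.BilinForm.toMatrix b q with hG
  have hdet : IsUnit G.det := Int.isUnit_iff.2 hq.unimodular
  let v := Matrix.vecMul (fun i => f (b i)) G⁻¹
  refine ⟨∑ i, v i • b i, fun x => ?_⟩
  have h : q (∑ i, v i • b i) = f := by
    refine b.ext fun j => ?_
    have h1 : Matrix.vecMul v G j = f (b j) := by
      rw [Matrix.vecMul_vecMul, Matrix.nonsing_inv_mul _ hdet, Matrix.vecMul_one]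
    rw [← h1]
    simp [Matrix.vecMul, dotProduct, hG, LinearMap.BilinForm.toMatrix_apply]
  rw [h]

theorem IsEvenUnimodularLattice.finrank_eq {L : Type*} [AddCommGroup L] [Module.Free ℤ L]
    [Module.Finite ℤ L] {q : LinearMap.BilinForm ℤ L} (hq : IsEvenUnimodularLattice q) :
    Module.finrank ℤ L = (latticeSignature q).1 + (latticeSignature q).2 := by
  set B := LinearMap.BilinForm.baseChange ℝ q with hB
  have hrad : (LinearMap.BilinMap.toQuadraticMap B).radical = ⊥ := by
    rw [eq_bot_iff]
    intro x hx
    have hpol : ∀ y, B x y + B y x = 0 := fun y => by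
      rw [← LinearMap.BilinMap.polar_toQuadraticMap]
      exact LinearMap.congr_fun hx.2 y
    have hsymm : ∀ y, B x y = B y x := fun y =>
      (LinearMap.BilinForm.IsSymm.baseChange ℝ (B₂ := q) ⟨hq.symm⟩).eq x y
    let b := Module.Free.chooseBasis ℤ L
    have hcoord : ∀ i, (Algebra.TensorProduct.basis ℝ b).repr x i = 0 := fun i => by
      obtain ⟨y, hy⟩ := hq.exists_forall_eq (b.coord i)
      have h : B (1 ⊗ₜ y) = (Algebra.TensorProduct.basis ℝ b).coord i := by
        refine (Algebra.TensorProduct.basis ℝ b).ext fun j => ?_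
        simp only [hB, Algebra.TensorProduct.basis_apply, LinearMap.BilinForm.baseChange_tmul, hy]
        by_cases hij : j = i
        · subst hij; simp
        · simp [Finsupp.single_eq_of_ne (Ne.symm hij)]
      rw [← Module.Basis.coord_apply, ← h]
      have h1 := hpol (1 ⊗ₜ y)
      rw [hsymm] at h1
      linarith
    exact (Submodule.mem_bot ℝ).2 ((Algebra.TensorProduct.basis ℝ b).repr.map_eq_zero_iff.1
      (Finsupp.ext hcoord))
  have h := QuadraticForm.sigPos_add_sigNeg_add_radical (Q := LinearMap.BilinMap.toQuadraticMap B)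
  rw [hrad, finrank_bot, add_zero, Module.finrank_baseChange] at h
  exact h.symm

theorem IsLatticeIsometry.pow {L : Type*} [AddCommGroup L] {q : LinearMap.BilinForm ℤ L}
    {t : Module.End ℤ L} (ht : IsLatticeIsometry q t) (n : ℕ) : IsLatticeIsometry q (t ^ n) := by
  induction n with
  | zero => intro x y; simp
  | succ n ih => intro x y; rw [pow_succ', Module.End.mul_apply, Module.End.mul_apply, ht, ih]

/-- The kernel and the image of `Φ₆₀(t)` are orthogonal. -/
theorem IsLatticeIsometry.cyclotomic_sixty_orthogonal {L : Type*} [AddCommGroup L]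
    {q : LinearMap.BilinForm ℤ L} {t : Module.End ℤ L} (ht : IsLatticeIsometry q t) (z : L) {x : L}
    (hx : x ∈ latticeKer t (cyclotomic 60 ℤ)) : q (aeval t (cyclotomic 60 ℤ) z) x = 0 := by
  have hx' : aeval t (cyclotomic 60 ℤ) x = 0 := hx
  have hpow : (t ^ 60) x = x := by
    obtain ⟨g, hg⟩ := cyclotomic_sixty_dvd_X_pow_sub_one
    have h : aeval t (X ^ 60 - 1 : ℤ[X]) x = 0 := by
      rw [hg, mul_comm, map_mul, Module.End.mul_apply, hx', map_zero]
    simpa [sub_eq_zero] using h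
  -- Since t⁶⁰ fixes x, w plays the role of t⁻¹⁶x; the palindromic symmetry of Φ₆₀ then moves Φ₆₀(t)
  -- across q.
  set w := (t ^ 44) x with hw
  have hxw : x = (t ^ 16) w := by rw [hw, ← Module.End.mul_apply, ← pow_add, hpow]
  have hwker : aeval t (cyclotomic 60 ℤ) w = 0 := by
    have h : aeval t (cyclotomic 60 ℤ) * t ^ 44 = t ^ 44 * aeval t (cyclotomic 60 ℤ) := by
      have h1 : t ^ 44 = aeval t (X ^ 44 : ℤ[X]) := by simp
      rw [h1, ← map_mul, ← map_mul, mul_comm]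
    rw [hw, ← Module.End.mul_apply, h, Module.End.mul_apply, hx', map_zero]
  have hmove : ∀ a b, a + b = 16 → q ((t ^ a) z) ((t ^ 16) w) = q z ((t ^ b) w) := by
    intro a b hab
    rw [← hab, pow_add, Module.End.mul_apply, ht.pow a]
  have h1 : q z (aeval t (cyclotomic 60 ℤ) w) = 0 := by rw [hwker, map_zero]
  rw [cyclotomic_sixty] at h1 ⊢
  rw [hxw]
  simp only [map_add, map_sub, map_pow, aeval_X, map_one, LinearMap.add_apply,
    LinearMap.sub_apply, Module.End.one_apply] at h1 ⊢
  rw [hmove 16 0 rfl, hmove 14 2 rfl, hmove 10 6 rfl, hmove 8 8 rfl, hmove 6 10 rfl,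
    hmove 2 14 rfl]
  have h0 := hmove 0 16 rfl
  rw [pow_zero, Module.End.one_apply] at h0
  rw [h0, pow_zero, Module.End.one_apply]
  linarith

theorem IsEvenUnimodularLattice.signature_ker_cyclotomic_sixty_ne {L : Type*} [AddCommGroup L]
    [Module.Free ℤ L] [Module.Finite ℤ L] {q : LinearMap.BilinForm ℤ L}
    (hq : IsEvenUnimodularLattice q) {t : Module.End ℤ L} (ht : IsLatticeIsometry q t) {f : ℤ[X]}
    (hf : IsProductOfCyclotomics f) (hdeg : f.natDegree ≤ 6)
    (hchar : t.charpoly = cyclotomic 60 ℤ * f) :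
    latticeSignature (q.restrict (latticeKer t (cyclotomic 60 ℤ))) ≠ (2, 14) := by
  set N := latticeKer t (cyclotomic 60 ℤ) with hN
  have hmem : ∀ {x}, x ∈ N ↔ aeval t (cyclotomic 60 ℤ) x = 0 := Iff.rfl
  have hzero : aeval t (cyclotomic 60 ℤ) * aeval t f = 0 := by
    rw [← map_mul, ← hchar, LinearMap.aeval_self_charpoly]
  obtain ⟨A, B, k, hAB⟩ := hf.exists_mul_cyclotomic_sixty_add hdeg
  have hproj : ∀ y, aeval t (B * f) y ∈ N := fun y => by
    rw [hmem, ← Module.End.mul_apply, mul_comm B f, map_mul, ← mul_assoc, hzero, zero_mul,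
      LinearMap.zero_apply]
  have hsum : ∀ y, (5 : ℤ) ^ k • y = aeval t (cyclotomic 60 ℤ) (aeval t A y) +
      aeval t (B * f) y := fun y => by
    rw [← Module.End.mul_apply, ← map_mul, ← LinearMap.add_apply, ← map_add, mul_comm _ A, hAB,
      map_pow, map_ofNat]
    have : (5 ^ k : Module.End ℤ L) = (5 : ℤ) ^ k • 1 := by
      rw [← Int.cast_smul_eq_zsmul ℤ, ← Algebra.algebraMap_eq_smul_one]
      simp
    rw [this, LinearMap.smul_apply, Module.End.one_apply]
  -- Up to the factor 5^k, the orthogonal projection onto N. One factor comes from extending a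
  -- functional along π, another from projecting its representing vector, whence k + k below.
  let π : L →ₗ[ℤ] N := (aeval t (B * f)).codRestrict N hproj
  have hπN : ∀ x : N, π x = (5 : ℤ) ^ k • x := fun x => by
    ext1
    have h := hsum x
    have h1 : aeval t (cyclotomic 60 ℤ) (aeval t A (x : L)) = 0 := by
      rw [← Module.End.mul_apply, ← map_mul, mul_comm, map_mul, Module.End.mul_apply,
        hmem.1 x.2, map_zero]
    rw [h1, zero_add] at h
    exact h.symm
  have hstable : ∀ x ∈ N, (t ^ 15) x ∈ N := fun x hx => by
    have h1 : t ^ 15 = aeval t (X ^ 15 : ℤ[X]) := by simp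
    rw [hmem, h1, ← Module.End.mul_apply, ← map_mul, mul_comm, map_mul, Module.End.mul_apply,
      hmem.1 hx, map_zero]
  refine latticeSignature_ne_of_sq_eq_neg (q.restrict N) (fun x y => hq.symm x y)
    (fun x => hq.even x) ((t ^ 15).restrict hstable) ?_ (fun x y => ht.pow 15 x y) (k + k) ?_
  · ext x
    obtain ⟨g, hg⟩ := cyclotomic_sixty_dvd_X_pow_thirty_add_one
    have h : aeval t (X ^ 30 + 1 : ℤ[X]) x = 0 := by
      rw [hg, mul_comm, map_mul, Module.End.mul_apply, hmem.1 x.2, map_zero]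
    have h2 : (t ^ 30) (x : L) = -x := by
      simpa [add_eq_zero_iff_eq_neg] using h
    rw [show 30 = 15 + 15 from rfl, pow_add, Module.End.mul_apply] at h2
    exact h2
  · intro g
    obtain ⟨y, hy⟩ := hq.exists_forall_eq (g ∘ₗ π)
    refine ⟨π y, fun x => ?_⟩
    have h1 := congrArg (fun u => q u x) (hsum y)
    simp only [map_add, LinearMap.add_apply] at h1
    rw [ht.cyclotomic_sixty_orthogonal _ x.2, zero_add] at h1
    have h2 : q (π y : L) x = 5 ^ k * q y x := by
      rw [map_smul, LinearMap.smul_apply, smul_eq_mul] at h1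
      exact h1.symm
    change q (π y : L) x = _
    rw [h2, hy, LinearMap.comp_apply, hπN, map_smul, smul_eq_mul, pow_add, mul_assoc]

theorem mainTheorem4 :
    (∀ (L : Type*) [AddCommGroup L] [Module.Free ℤ L] [Module.Finite ℤ L]
      (q : LinearMap.BilinForm ℤ L),
      IsEvenUnimodularLattice q → latticeSignature q = (3, 19) →
      ¬ ∃ t : Module.End ℤ L, IsLatticeIsometry q t ∧
        (∃ C' : ℤ[X], IsProductOfCyclotomics C' ∧ t.charpoly = cyclotomic 60 ℤ * C') ∧
        latticeSignature (q.restrict (latticeKer t (cyclotomic 60 ℤ))) = (2, 14)) ∧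
    (∀ (M : Type*) [AddCommGroup M] [Module.Free ℤ M] [Module.Finite ℤ M]
      (q : LinearMap.BilinForm ℤ M),
      IsEvenUnimodularLattice q → latticeSignature q = (2, 18) →
      ¬ ∃ t : Module.End ℤ M, IsLatticeIsometry q t ∧
        t.charpoly = cyclotomic 60 ℤ * cyclotomic 12 ℤ ∧
        latticeSignature (q.restrict (latticeKer t (cyclotomic 60 ℤ))) = (2, 14)) := by
  refine ⟨?_, ?_⟩
  · rintro L _ _ _ q hq hsig ⟨t, ht, ⟨f, hf, hchar⟩, hker⟩
    refine hq.signature_ker_cyclotomic_sixty_ne ht hf ?_ hchar hker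
    have hf0 : f ≠ 0 := by
      rintro rfl
      exact t.charpoly_monic.ne_zero (by rw [hchar, mul_zero])
    -- The rank 3 + 19 = 22 leaves degree 22 - 16 = 6 for the cofactor.
    have h1 := t.charpoly_natDegree
    rw [hchar, natDegree_mul (cyclotomic_ne_zero 60 ℤ) hf0, natDegree_cyclotomic, hq.finrank_eq,
      hsig, show Nat.totient 60 = 16 by decide +kernel] at h1
    omega
  · rintro M _ _ _ q hq - ⟨t, ht, hchar, hker⟩
    refine hq.signature_ker_cyclotomic_sixty_ne ht ⟨{12}, by simp, by simp⟩ ?_ hchar hker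
    rw [natDegree_cyclotomic]
    decide +kernel
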